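/- Sorts are built from the single ground sort $\mathsf{o}$ by $\to$; $\mathit{ord}(\mathsf{o})=0$ and $\mathit{ord}(\alpha\to\beta)=\max(1+\mathit{ord}(\alpha),\mathit{ord}(\beta))$. A sort $\alpha_1\to\dots\to\alpha_k\to\mathsf{o}$ is homogeneous if $\mathit{ord}(\alpha_1)\ge\dots\ge\mathit{ord}(\alpha_k)$ and all $\alpha_i$ are homogeneous. We consider simply typed lambda-terms (up to alpha-conversion) over the constants $a:\mathsf{o}\to\mathsf{o}$, $b:\mathsf{o}\to\mathsf{o}\to\mathsf{o}$, $e:\mathsf{o}$. The complexity of a term is the maximum of the orders of (the sorts of) its subterms; a term is homogeneous if all its subterms have homogeneous sorts. *Types.* Put $\mathcal T^{\mathsf{o}}=\{\mathsf{r}\}$ and $\mathcal T^{\alpha\to\beta}=\mathcal P(\{\mathsf{pr},\mathsf{np}\}\times\mathcal T^{\alpha})\times\mathcal T^{\beta}$; write $\bigwedge T\to\tau$ for $(T,\tau)$. A type environment $\Gamma$ is a set of bindings $x:(f,\tau)$, where $x$ is a variable of some sort $\alpha$, $\tau\in\mathcal T^\alpha$ and $f\in\{\mathsf{pr},\mathsf{np}\}$;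 $\Gamma{\restriction}_{\mathsf{pr}}$ is the set of its bindings with flag $\mathsf{pr}$, and $\mathit{dom}(\Gamma)$ is the set of variables bound in it. Judgments $\Gamma\vdash M:(f,\tau)$, with $\tau\in\mathcal T^\alpha$ for $M$ of sort $\alpha$, are derived by the following rules. - $\vdash a:(\mathsf{pr},(f,\mathsf{r})\to\mathsf{r})$, $\;\vdash b:(\mathsf{np},(f_1,\mathsf{r})\to(f_2,\mathsf{r})\to\mathsf{r})$, $\;\vdash e:(\mathsf{np},\mathsf{r})$, for arbitrary flags $f,f_1,f_2$. - $x:(f,\tau)\vdash x:(\mathsf{np},\tau)$. - $(\lambda)$: from $\Gamma\cup\{x:(f_i,\tau_i)\mid i\in I\}\vdash K:(f,\tau)$ with $x\notin\mathit{dom}(\Gamma)$ infer $\Gamma\vdash\lambda x.K:(f,\bigwedge_{i\in I}(f_i,\tau_i)\to\tau)$. - $(@)$: from $\Gamma\vdash K:(f',\bigwedge_{i\in I}(f_i^\bullet,\tau_i)\to\tau)$ and $\Gamma_i\vdash L:(f_i^\circ,\tau_i)$ for each $i\in I$ infer $\Gamma\cup\bigcup_{i\in I}\Gamma_i\vdash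 K\,L:(f,\tau)$, provided that the pairs $(f_i^\bullet,\tau_i)$ are pairwise different; that for each $i$, $f_i^\bullet=\mathsf{pr}$ if and only if $f_i^\circ=\mathsf{pr}$ or $\Gamma_i{\restriction}_{\mathsf{pr}}\ne\emptyset$; and that $f=\mathsf{pr}$ if and only if $f'=\mathsf{pr}$, or $f_i^\circ=\mathsf{pr}$ for some $i\in I$, or $|\Gamma{\restriction}_{\mathsf{pr}}|+\sum_{i\in I}|\Gamma_i{\restriction}_{\mathsf{pr}}|>|(\Gamma\cup\bigcup_{i\in I}\Gamma_i){\restriction}_{\mathsf{pr}}|$. The value $\mathit{val}(D)$ of a derivation $D$ is the sum of the values of its nodes, where a node using the rule for $a$ has value $1$, a node using $(@)$ has value $|\Gamma{\restriction}_{\mathsf{pr}}|+\sum_{i\in I}|\Gamma_i{\restriction}_{\mathsf{pr}}|-|(\Gamma\cup\bigcup_{i\in I}\Gamma_i){\restriction}_{\mathsf{pr}}|$, and every other node has value $0$. **Theorem.** (D1) For every $m\in\mathbb N$ there is a function $\eta_m:\mathbb N\to\mathbb N$ such that, if $M$ is a homogeneous closed lambda-term of sort $\mathsf{o}$ and of complexity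 at most $m$, and $D$ is a derivation of $\vdash M:(f,\mathsf{r})$ for some flag $f$, then the number of occurrences of the constant $a$ in the (existing and unique) $\beta$-normal form of $M$ is at least $\mathit{val}(D)$ and at most $\eta_m(\mathit{val}(D))$. (D2) For every closed lambda-term $M$ of sort $\mathsf{o}$ there is a flag $f\in\{\mathsf{pr},\mathsf{np}\}$ such that $\vdash M:(f,\mathsf{r})$ can be derived. -/

import Mathlib

namespace Stlc

/-! ### Sorts and simply typed lambda-terms -/

/-- Sorts (simple types) over the single ground sort `o`. -/
inductive Srt : Type
  | o : Srt
  | arr : Srt → Srt → Srt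
  deriving DecidableEq

/-- The order of a sort. -/
def Srt.ord : Srt → ℕ
  | .o => 0
  | .arr α β => max (1 + α.ord) β.ord

/-- `α₁ → ⋯ → αₖ → o` is homogeneous when `ord α₁ ≥ ⋯ ≥ ord αₖ` and every `αᵢ` is homogeneous. -/
def Srt.Homogeneous : Srt → Prop
  | .o => True
  | .arr α .o => α.Homogeneous
  | .arr α (.arr α' β) =>
      α.Homogeneous ∧ α'.ord ≤ α.ord ∧ (Srt.arr α' β).Homogeneous

/-- Variables as well-sorted de Bruijn indices; a context lists the sorts of the variables
that may occur free, the most recently bound one first. -/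
inductive Var : List Srt → Srt → Type
  | zero {Δ : List Srt} {α : Srt} : Var (α :: Δ) α
  | succ {Δ : List Srt} {α β : Srt} : Var Δ α → Var (β :: Δ) α
  deriving DecidableEq

/-- `Tm Δ α`: the simply typed lambda-terms of sort `α`, up to alpha-conversion, with free
variables in `Δ`, over the signature `a : o → o`, `b : o → o → o`, `e : o`.
The closed terms of sort `α` are the elements of `Tm [] α`. -/
inductive Tm : List Srt → Srt → Type
  | a {Δ : List Srt} : Tm Δ (.arr .o .o)
  | b {Δ : List Srt} : Tm Δ (.arr .o (.arr .o .o))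
  | e {Δ : List Srt} : Tm Δ .o
  | var {Δ : List Srt} {α : Srt} : Var Δ α → Tm Δ α
  | lam {Δ : List Srt} {α β : Srt} : Tm (α :: Δ) β → Tm Δ (.arr α β)
  | app {Δ : List Srt} {α β : Srt} : Tm Δ (.arr α β) → Tm Δ α → Tm Δ β

/-- The maximum of the orders of the subterms. -/
def Tm.complexity : {Δ : List Srt} → {α : Srt} → Tm Δ α → ℕ
  | _, _, .a => (Srt.arr .o .o).ord
  | _, _, .b => (Srt.arr .o (.arr .o .o)).ord
  | _, _, .e => Srt.o.ord
  | _, α, .var _ => α.ord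
  | _, _, .lam (α := α) (β := β) K => max (Srt.arr α β).ord K.complexity
  | _, α, .app K L => max α.ord (max K.complexity L.complexity)

/-- All subterms have homogeneous sorts. -/
def Tm.Homogeneous : {Δ : List Srt} → {α : Srt} → Tm Δ α → Prop
  | _, _, .a => (Srt.arr .o .o).Homogeneous
  | _, _, .b => (Srt.arr .o (.arr .o .o)).Homogeneous
  | _, _, .e => Srt.o.Homogeneous
  | _, α, .var _ => α.Homogeneous
  | _, _, .lam (α := α) (β := β) K => (Srt.arr α β).Homogeneous ∧ K.Homogeneous
  | _, α, .app K L => α.Homogeneous ∧ K.Homogeneous ∧ L.Homogeneous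

/-- The number of occurrences of the constant `a`. -/
def Tm.countA : {Δ : List Srt} → {α : Srt} → Tm Δ α → ℕ
  | _, _, .a => 1
  | _, _, .b => 0
  | _, _, .e => 0
  | _, _, .var _ => 0
  | _, _, .lam K => K.countA
  | _, _, .app K L => K.countA + L.countA

/-! ### Substitution and beta-reduction -/

/-- Extension of a renaming under a binder. -/
def Var.lift {Δ Θ : List Srt} (ρ : ∀ α, Var Δ α → Var Θ α) (γ : Srt) :
    ∀ α, Var (γ :: Δ) α → Var (γ :: Θ) α
  | _, .zero => .zero
  | _, .succ x => .succ (ρ _ x)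

/-- Renaming of free variables. -/
def Tm.rename : {Δ Θ : List Srt} → {α : Srt} → (∀ α, Var Δ α → Var Θ α) → Tm Δ α → Tm Θ α
  | _, _, _, _, .a => .a
  | _, _, _, _, .b => .b
  | _, _, _, _, .e => .e
  | _, _, _, ρ, .var x => .var (ρ _ x)
  | _, _, _, ρ, .lam K => .lam (K.rename (Var.lift ρ _))
  | _, _, _, ρ, .app K L => .app (K.rename ρ) (L.rename ρ)

/-- Extension of a substitution under a binder. -/
def Tm.liftSubst {Δ Θ : List Srt} (σ : ∀ α, Var Δ α → Tm Θ α) (γ : Srt) :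
    ∀ α, Var (γ :: Δ) α → Tm (γ :: Θ) α
  | _, .zero => .var .zero
  | _, .succ x => (σ _ x).rename (fun _ => Var.succ)

/-- Simultaneous capture-avoiding substitution. -/
def Tm.subst : {Δ Θ : List Srt} → {α : Srt} → (∀ α, Var Δ α → Tm Θ α) → Tm Δ α → Tm Θ α
  | _, _, _, _, .a => .a
  | _, _, _, _, .b => .b
  | _, _, _, _, .e => .e
  | _, _, _, σ, .var x => σ _ x
  | _, _, _, σ, .lam K => .lam (K.subst (Tm.liftSubst σ _))
  | _, _, _, σ, .app K L => .app (K.subst σ) (L.subst σ)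

/-- The substitution sending the last bound variable to `L` and fixing the others. -/
def Tm.single {Δ : List Srt} {γ : Srt} (L : Tm Δ γ) : ∀ α, Var (γ :: Δ) α → Tm Δ α
  | _, .zero => L
  | _, .succ x => .var x

/-- `K[L/x]`, where `x` is the last bound variable of `K`. -/
def Tm.inst {Δ : List Srt} {α β : Srt} (K : Tm (α :: Δ) β) (L : Tm Δ α) : Tm Δ β :=
  K.subst (Tm.single L)

/-- One-step beta-reduction. -/
inductive Beta : {Δ : List Srt} → {α : Srt} → Tm Δ α → Tm Δ α → Prop
  | beta {Δ : List Srt} {α β : Srt} (K : Tm (α :: Δ) β) (L : Tm Δ α) :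
      Beta (.app (.lam K) L) (K.inst L)
  | lam {Δ : List Srt} {α β : Srt} {K K' : Tm (α :: Δ) β} :
      Beta K K' → Beta (.lam K) (.lam K')
  | appLeft {Δ : List Srt} {α β : Srt} {K K' : Tm Δ (.arr α β)} {L : Tm Δ α} :
      Beta K K' → Beta (.app K L) (.app K' L)
  | appRight {Δ : List Srt} {α β : Srt} {K : Tm Δ (.arr α β)} {L L' : Tm Δ α} :
      Beta L L' → Beta (.app K L) (.app K L')

/-- `N` is a beta-normal form of `M`. -/
def IsNormalFormOf {Δ : List Srt} {α : Srt} (N M : Tm Δ α) : Prop :=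
  Relation.ReflTransGen Beta M N ∧ ∀ N', ¬ Beta N N'

/-! ### Intersection types with productivity flags -/

/-- Productivity flags: productive and nonproductive. -/
inductive PFlag : Type
  | pr : PFlag
  | np : PFlag
  deriving DecidableEq

/-- The types refining a sort: a single type for `o`, and for `α → β` the pairs `(T, τ)` of a set
`T` of flagged types of sort `α` and a type `τ` of sort `β`. There are finitely many types of each
sort, so that all sets of flagged types are finite. -/
def Ty : Srt → Type
  | .o => Unit
  | .arr α β => Finset (PFlag × Ty α) × Ty β

instance Ty.instDecidableEq : (α : Srt) → DecidableEq (Ty α)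
  | .o => inferInstanceAs (DecidableEq Unit)
  | .arr α β =>
      have := Ty.instDecidableEq α
      have := Ty.instDecidableEq β
      inferInstanceAs (DecidableEq (Finset (PFlag × Ty α) × Ty β))

/-- The unique type of sort `o`. -/
def Ty.r : Ty .o := ()

/-- The type `⋀ T → τ`. -/
def Ty.arrow {α β : Srt} (T : Finset (PFlag × Ty α)) (τ : Ty β) : Ty (.arr α β) := (T, τ)

/-- A type binding `x : (f, τ)` for a variable of the context `Δ`. -/
structure Binding (Δ : List Srt) : Type where
  {sort : Srt}
  var : Var Δ sort
  flag : PFlag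
  ty : Ty sort
  deriving DecidableEq

/-- A type environment is a (finite) set of type bindings. -/
abbrev Env (Δ : List Srt) : Type := Finset (Binding Δ)

/-- The productive bindings of an environment. -/
def Env.prod {Δ : List Srt} (Γ : Env Δ) : Env Δ := Γ.filter (fun B => B.flag = .pr)

/-- The environment `Γ` seen in a context with one more variable, which it does not bind. -/
def Env.weaken {Δ : List Srt} (γ : Srt) (Γ : Env Δ) : Env (γ :: Δ) :=
  Γ.image (fun B => ⟨B.var.succ, B.flag, B.ty⟩)

/-- The environment `{x : (f, τ) | (f, τ) ∈ T}` for the last bound variable `x`. -/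
def Env.bind {Δ : List Srt} {γ : Srt} (T : Finset (PFlag × Ty γ)) : Env (γ :: Δ) :=
  T.image (fun p => ⟨Var.zero, p.1, p.2⟩)

/-- For an application with environments `Γ` and `Γs i`, the number of productive bindings in all
these environments together, minus the number of productive bindings in their union. -/
def Env.dup {Δ : List Srt} {ι : Type} [Fintype ι] (Γ : Env Δ) (Γs : ι → Env Δ) : ℕ :=
  ((Env.prod Γ).card + ∑ i, (Env.prod (Γs i)).card)
    - (Env.prod (Γ ∪ Finset.univ.biUnion Γs)).card

/-- `Deriv Γ M f τ`: the derivations (trees) of the type judgment `Γ ⊢ M : (f, τ)`.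
In the rule for application the pairs `(f•ᵢ, τᵢ)` are required to be pairwise different, so the
index set is the set `T` of these pairs itself, and `fo i` is the flag `f°ᵢ` derived for the
argument. -/
inductive Deriv : {Δ : List Srt} → {α : Srt} → Env Δ → Tm Δ α → PFlag → Ty α → Type
  | a {Δ : List Srt} (f : PFlag) :
      Deriv (Δ := Δ) ∅ .a .pr (Ty.arrow {(f, Ty.r)} Ty.r)
  | b {Δ : List Srt} (f₁ f₂ : PFlag) :
      Deriv (Δ := Δ) ∅ .b .np (Ty.arrow {(f₁, Ty.r)} (Ty.arrow {(f₂, Ty.r)} Ty.r))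
  | e {Δ : List Srt} :
      Deriv (Δ := Δ) ∅ .e .np Ty.r
  | var {Δ : List Srt} {α : Srt} (x : Var Δ α) (f : PFlag) (τ : Ty α) :
      Deriv {⟨x, f, τ⟩} (.var x) .np τ
  | lam {Δ : List Srt} {α β : Srt} {K : Tm (α :: Δ) β} {Γ : Env Δ} {Γ' : Env (α :: Δ)}
      {T : Finset (PFlag × Ty α)} {f : PFlag} {τ : Ty β}
      (hΓ' : Γ' = Env.weaken α Γ ∪ Env.bind T)
      (D : Deriv Γ' K f τ) :
      Deriv Γ (.lam K) f (Ty.arrow T τ)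
  | app {Δ : List Srt} {α β : Srt} {K : Tm Δ (.arr α β)} {L : Tm Δ α} {Γ Θ : Env Δ}
      {T : Finset (PFlag × Ty α)} {τ : Ty β} {f f' : PFlag}
      {Γs : {p // p ∈ T} → Env Δ} {fo : {p // p ∈ T} → PFlag}
      (DK : Deriv Γ K f' (Ty.arrow T τ))
      (DL : ∀ i : {p // p ∈ T}, Deriv (Γs i) L (fo i) i.1.2)
      (hT : ∀ i : {p // p ∈ T}, i.1.1 = .pr ↔ (fo i = .pr ∨ Env.prod (Γs i) ≠ ∅))
      (hf : f = .pr ↔ (f' = .pr ∨ (∃ i, fo i = .pr) ∨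
        (Env.prod Γ).card + ∑ i, (Env.prod (Γs i)).card
          > (Env.prod (Γ ∪ Finset.univ.biUnion Γs)).card))
      (hΘ : Θ = Γ ∪ Finset.univ.biUnion Γs) :
      Deriv Θ (.app K L) f τ

/-- The value of a derivation: the sum of the values of its nodes, which are `1` at the rule for
the constant `a`, the number of duplicated productive bindings at an application, and `0`
elsewhere. -/
def Deriv.val : {Δ : List Srt} → {α : Srt} → {Γ : Env Δ} → {M : Tm Δ α} → {f : PFlag} →
    {τ : Ty α} → Deriv Γ M f τ → ℕ
  | _, _, _, _, _, _, .a _ => 1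
  | _, _, _, _, _, _, .b _ _ => 0
  | _, _, _, _, _, _, .e => 0
  | _, _, _, _, _, _, .var _ _ _ => 0
  | _, _, _, _, _, _, .lam _ D => D.val
  | _, _, _, _, _, _, .app (Γ := Γ) (Γs := Γs) DK DL _ _ _ =>
      Env.dup Γ Γs + (DK.val + ∑ i, (DL i).val)

end Stlc

namespace Stlc

/-! Evaluation in the full function hierarchy is invariant under β-reduction, and over `countAlg` a
closed ground term evaluates to the number of `a` in its normal form. So (D1) amounts to two bounds
on `Tm.eval countAlg`, each proved by induction on the derivation through a logical relation between
types and semantic elements.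

Lower bound (`lower_eval`): assumptions carry weights, at least one if productive and zero
otherwise. A term produces at least the total weight of its environment plus the value of its
derivation, since a productive binding used `k` times yields `k` times its weight, hence a surplus
of at least `k - 1`, which is what the value charges.

Upper bound (`exists_upper_eval`): weights are vectors indexed by orders and evaluated by a tower of
exponentials. Doubling a vector supported on levels up to `j` costs at most one unit at level `j +
1` (`tower_double`), so every extra copy of a productive binding of order `j` is paid for by one
such unit, already counted in the value. The weight of an argument of order `j` can be moved to
levels up to `j` without loss (`Upper.collapse`, `dom_collapse`). The height of the tower depends on
the complexity only.

(D2) is the fundamental lemma `total_typesOf` for hereditary nonemptiness of the set of derivable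
flagged types. -/

/-! ### Evaluation in the full function hierarchy over an algebra -/

/-- The full function hierarchy over `X`. -/
def Sem (X : Type) : Srt → Type
  | .o => X
  | .arr α β => Sem X α → Sem X β

/-- An algebra interpreting the constants `a`, `b`, `e`. -/
structure Alg (X : Type) where
  a : X → X
  b : X → X → X
  e : X

/-- Valuations of the variables of a context. -/
abbrev Valn (X : Type) (Δ : List Srt) : Type := ∀ α, Var Δ α → Sem X α

def Valn.cons {X : Type} {Δ : List Srt} {γ : Srt} (d : Sem X γ) (ρ : Valn X Δ) :
    Valn X (γ :: Δ)
  | _, .zero => d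
  | _, .succ x => ρ _ x

def Tm.eval {X : Type} (A : Alg X) : {Δ : List Srt} → {α : Srt} → Tm Δ α → Valn X Δ → Sem X α
  | _, _, .a, _ => A.a
  | _, _, .b, _ => A.b
  | _, _, .e, _ => A.e
  | _, _, .var x, ρ => ρ _ x
  | _, _, .lam K, ρ => fun d => K.eval A (ρ.cons d)
  | _, _, .app K L, ρ => (K.eval A ρ) (L.eval A ρ)

section Eval

variable {X : Type} (A : Alg X)

theorem Tm.eval_rename {Δ Θ : List Srt} {α : Srt} (M : Tm Δ α) (r : ∀ α, Var Δ α → Var Θ α)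
    (ρ : Valn X Θ) : (M.rename r).eval A ρ = M.eval A (fun _ x => ρ _ (r _ x)) := by
  induction M generalizing Θ with
  | a => rfl
  | b => rfl
  | e => rfl
  | var x => rfl
  | lam K ih =>
    funext d
    simp only [Tm.rename, Tm.eval, ih]
    congr 1
    funext _ x
    cases x <;> rfl
  | app K L ihK ihL => simp only [Tm.rename, Tm.eval, ihK, ihL]

theorem Tm.eval_subst {Δ Θ : List Srt} {α : Srt} (M : Tm Δ α) (σ : ∀ α, Var Δ α → Tm Θ α)
    (ρ : Valn X Θ) : (M.subst σ).eval A ρ = M.eval A (fun _ x => (σ _ x).eval A ρ) := by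
  induction M generalizing Θ with
  | a => rfl
  | b => rfl
  | e => rfl
  | var x => rfl
  | lam K ih =>
    funext d
    simp only [Tm.subst, Tm.eval, ih]
    congr 1
    funext _ x
    cases x with
    | zero => rfl
    | succ x => exact Tm.eval_rename A _ _ _
  | app K L ihK ihL => simp only [Tm.subst, Tm.eval, ihK, ihL]

theorem Tm.eval_inst {Δ : List Srt} {α β : Srt} (K : Tm (α :: Δ) β) (L : Tm Δ α)
    (ρ : Valn X Δ) : (K.inst L).eval A ρ = K.eval A (ρ.cons (L.eval A ρ)) := by
  rw [Tm.inst, Tm.eval_subst]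
  congr 1
  funext _ x
  cases x <;> rfl

theorem Beta.eval_eq {Δ : List Srt} {α : Srt} {M N : Tm Δ α} (h : Beta M N) (ρ : Valn X Δ) :
    M.eval A ρ = N.eval A ρ := by
  induction h with
  | beta K L => exact (Tm.eval_inst A K L ρ).symm
  | lam _ ih => funext d; exact ih _
  | appLeft _ ih => simp only [Tm.eval, ih]
  | appRight _ ih => simp only [Tm.eval, ih]

theorem eval_eq_of_reflTransGen {Δ : List Srt} {α : Srt} {M N : Tm Δ α}
    (h : Relation.ReflTransGen Beta M N) (ρ : Valn X Δ) : M.eval A ρ = N.eval A ρ := by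
  induction h with
  | refl => rfl
  | tail _ h ih => exact ih.trans (h.eval_eq A ρ)

end Eval

/-- The empty valuation. -/
def Valn.nil {X : Type} : Valn X [] := fun _ x => nomatch x

/-! ### Composition of substitutions -/

theorem Tm.rename_rename {Δ Θ Ξ : List Srt} {α : Srt} (M : Tm Δ α)
    (r : ∀ α, Var Δ α → Var Θ α) (s : ∀ α, Var Θ α → Var Ξ α) :
    (M.rename r).rename s = M.rename (fun _ x => s _ (r _ x)) := by
  induction M generalizing Θ Ξ with
  | a => rfl
  | b => rfl
  | e => rfl
  | var x => rfl
  | lam K ih =>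
    simp only [Tm.rename, ih]
    congr 2
    funext _ x
    cases x <;> rfl
  | app K L ihK ihL => simp only [Tm.rename, ihK, ihL]

theorem Tm.subst_rename {Δ Θ Ξ : List Srt} {α : Srt} (M : Tm Δ α)
    (r : ∀ α, Var Δ α → Var Θ α) (σ : ∀ α, Var Θ α → Tm Ξ α) :
    (M.rename r).subst σ = M.subst (fun _ x => σ _ (r _ x)) := by
  induction M generalizing Θ Ξ with
  | a => rfl
  | b => rfl
  | e => rfl
  | var x => rfl
  | lam K ih =>
    simp only [Tm.rename, Tm.subst, ih]
    congr 2
    funext _ x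
    cases x <;> rfl
  | app K L ihK ihL => simp only [Tm.rename, Tm.subst, ihK, ihL]

theorem Tm.rename_subst {Δ Θ Ξ : List Srt} {α : Srt} (M : Tm Δ α)
    (σ : ∀ α, Var Δ α → Tm Θ α) (r : ∀ α, Var Θ α → Var Ξ α) :
    (M.subst σ).rename r = M.subst (fun _ x => (σ _ x).rename r) := by
  induction M generalizing Θ Ξ with
  | a => rfl
  | b => rfl
  | e => rfl
  | var x => rfl
  | lam K ih =>
    simp only [Tm.rename, Tm.subst, ih]
    congr 2
    funext _ x
    cases x with
    | zero => rfl
    | succ x => simp only [Tm.liftSubst, Tm.rename_rename]; rfl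
  | app K L ihK ihL => simp only [Tm.rename, Tm.subst, ihK, ihL]

theorem Tm.subst_subst {Δ Θ Ξ : List Srt} {α : Srt} (M : Tm Δ α)
    (σ : ∀ α, Var Δ α → Tm Θ α) (σ' : ∀ α, Var Θ α → Tm Ξ α) :
    (M.subst σ).subst σ' = M.subst (fun _ x => (σ _ x).subst σ') := by
  induction M generalizing Θ Ξ with
  | a => rfl
  | b => rfl
  | e => rfl
  | var x => rfl
  | lam K ih =>
    simp only [Tm.subst, ih]
    congr 2
    funext _ x
    cases x with
    | zero => rfl
    | succ x => simp only [Tm.liftSubst, Tm.subst_rename, Tm.rename_subst]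
  | app K L ihK ihL => simp only [Tm.subst, ihK, ihL]

theorem Tm.subst_var {Δ : List Srt} {α : Srt} (M : Tm Δ α) :
    M.subst (fun _ x => .var x) = M := by
  induction M with
  | a => rfl
  | b => rfl
  | e => rfl
  | var x => rfl
  | lam K ih =>
    have h : ∀ (Δ : List Srt) (γ : Srt), Tm.liftSubst (Δ := Δ) (fun _ x => .var x) γ =
        fun _ x => .var x := by
      intro Δ γ
      funext _ x
      cases x <;> rfl
    simp only [Tm.subst, h, ih]
  | app K L ihK ihL => simp only [Tm.subst, ihK, ihL]

/-- Extension of a substitution by a term for the last bound variable. -/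
def Tm.consSubst {Δ Θ : List Srt} {γ : Srt} (L : Tm Θ γ) (σ : ∀ α, Var Δ α → Tm Θ α) :
    ∀ α, Var (γ :: Δ) α → Tm Θ α
  | _, .zero => L
  | _, .succ x => σ _ x

theorem Tm.inst_subst_lift {Δ Θ : List Srt} {γ β : Srt} (K : Tm (γ :: Δ) β)
    (σ : ∀ α, Var Δ α → Tm Θ α) (L : Tm Θ γ) :
    (K.subst (Tm.liftSubst σ γ)).inst L = K.subst (Tm.consSubst L σ) := by
  rw [Tm.inst, Tm.subst_subst]
  congr 1
  funext _ x
  cases x with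
  | zero => rfl
  | succ x =>
    simp only [Tm.liftSubst, Tm.subst_rename, Tm.consSubst, Tm.single]
    exact Tm.subst_var _

/-! ### Normal forms of closed terms of ground sort -/

/-- Trees built from the constants. -/
inductive IsTree : Tm [] .o → Prop
  | a {t : Tm [] .o} : IsTree t → IsTree (.app .a t)
  | b {t u : Tm [] .o} : IsTree t → IsTree u → IsTree (.app (.app .b t) u)
  | e : IsTree .e

theorem IsTree.not_beta {t : Tm [] .o} (h : IsTree t) (t' : Tm [] .o) : ¬ Beta t t' := by
  induction h generalizing t' with
  | a _ ih =>
    rintro (_ | _ | h | h)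
    · cases h
    · exact ih _ h
  | b _ _ ih₁ ih₂ =>
    rintro (_ | _ | h | h)
    · rcases h with _ | _ | h | h
      · cases h
      · exact ih₁ _ h
    · exact ih₂ _ h
  | e => intro h; cases h

/-- The algebra of closed terms of ground sort. -/
def termAlg : Alg (Tm [] .o) := ⟨fun t => .app .a t, fun t u => .app (.app .b t) u, .e⟩

/-- The algebra counting the occurrences of `a`. -/
def countAlg : Alg ℕ := ⟨fun n => n + 1, fun n k => n + k, 0⟩

theorem IsTree.eval_termAlg {t : Tm [] .o} (h : IsTree t) : t.eval termAlg Valn.nil = t := by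
  induction h with
  | a _ ih => simp only [Tm.eval, ih]; rfl
  | b _ _ ih₁ ih₂ => simp only [Tm.eval, ih₁, ih₂]; rfl
  | e => rfl

theorem IsTree.eval_countAlg {t : Tm [] .o} (h : IsTree t) :
    t.eval countAlg Valn.nil = t.countA := by
  induction h with
  | a _ ih => simp only [Tm.eval, ih, Tm.countA]; exact Nat.add_comm _ _
  | b _ _ ih₁ ih₂ => simp only [Tm.eval, ih₁, ih₂, Tm.countA, Nat.zero_add]; rfl
  | e => rfl

/-- Reducibility: hereditarily, reducing to a tree. -/
def Red : {α : Srt} → Tm [] α → Prop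
  | .o, M => ∃ t, IsTree t ∧ Relation.ReflTransGen Beta M t
  | .arr _ _, M => ∀ L, Red L → Red (.app M L)

theorem Red.expand {α : Srt} {M M' : Tm [] α} (h : Beta M M') (hM : Red M') : Red M := by
  induction α with
  | o =>
    obtain ⟨t, ht, h'⟩ := hM
    exact ⟨t, ht, .head h h'⟩
  | arr α β _ ih => exact fun L hL => ih (.appLeft h) (hM L hL)

theorem red_subst {Δ : List Srt} {α : Srt} (M : Tm Δ α) (σ : ∀ α, Var Δ α → Tm [] α)
    (hσ : ∀ α x, Red (σ α x)) : Red (M.subst σ) := by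
  induction M with
  | a =>
    rintro L ⟨t, ht, h⟩
    exact ⟨_, .a ht, h.lift (Tm.app Tm.a) fun _ _ => .appRight⟩
  | b =>
    rintro L ⟨t, ht, h⟩ L' ⟨t', ht', h'⟩
    exact ⟨_, .b ht ht', (h.lift (fun s => Tm.app (Tm.app Tm.b s) L')
      fun _ _ h => .appLeft (.appRight h)).trans
        (h'.lift (fun s => Tm.app (Tm.app Tm.b t) s) fun _ _ h => .appRight h)⟩
  | e => exact ⟨_, .e, .refl⟩
  | var x => exact hσ _ x
  | lam K ih =>
    intro L hL
    refine Red.expand (.beta _ _) ?_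
    rw [Tm.inst_subst_lift]
    refine ih _ fun β x => ?_
    cases x with
    | zero => exact hL
    | succ x => exact hσ _ x
  | app K L ihK ihL => exact ihK σ hσ _ (ihL σ hσ)

theorem exists_tree (M : Tm [] .o) : ∃ t, IsTree t ∧ Relation.ReflTransGen Beta M t := by
  have h := red_subst M (fun _ x => .var x) (fun _ x => nomatch x)
  rwa [Tm.subst_var] at h

/-- A closed term of ground sort has a unique normal form, whose occurrences of `a` are counted by
evaluating the term. -/
theorem exists_unique_normalForm (M : Tm [] .o) :
    ∃ N, IsNormalFormOf N M ∧ (∀ N', IsNormalFormOf N' M → N' = N) ∧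
      N.countA = M.eval countAlg Valn.nil := by
  obtain ⟨t, ht, h⟩ := exists_tree M
  refine ⟨t, ⟨h, ht.not_beta⟩, ?_, ?_⟩
  · rintro N ⟨hN, hn⟩
    obtain ⟨u, hu, h'⟩ := exists_tree N
    -- Uniqueness needs no confluence: a normal form equals the tree it reduces to, and a tree is
    -- recovered from its β-invariant value in `termAlg`.
    have hNu : N = u := by
      rcases h'.cases_head with h' | ⟨_, h', _⟩
      · exact h'
      · exact absurd h' (hn _)
    subst hNu
    rw [← hu.eval_termAlg, ← ht.eval_termAlg, ← eval_eq_of_reflTransGen _ h,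
      ← eval_eq_of_reflTransGen _ hN]
  · rw [← ht.eval_countAlg, ← eval_eq_of_reflTransGen _ h]

/-! ### Every closed term of ground sort has a type -/

/-- Sets of flagged types that are hereditarily nonempty. -/
def Total : {α : Srt} → Set (PFlag × Ty α) → Prop
  | .o, X => X.Nonempty
  | .arr α β, X => ∀ Y : Set (PFlag × Ty α), Total Y →
      Total {q : PFlag × Ty β | ∃ (f' : PFlag) (T : Finset (PFlag × Ty α)), (∀ p ∈ T, p ∈ Y) ∧
        (f', Ty.arrow T q.2) ∈ X ∧ (q.1 = .pr ↔ f' = .pr ∨ ∃ p ∈ T, p.1 = .pr)}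

theorem Total.mono {α : Srt} {X X' : Set (PFlag × Ty α)} (hX : Total X) (h : X ⊆ X') :
    Total X' := by
  induction α with
  | o => exact Set.Nonempty.mono h hX
  | arr α β _ ih =>
    intro Y hY
    refine ih (hX Y hY) ?_
    rintro q ⟨f', T, hT, hq, hf⟩
    exact ⟨f', T, hT, h hq, hf⟩

/-- The flagged types derivable from type assumptions; productive assumptions count as
productivity of the term. -/
def typesOf {Δ : List Srt} {α : Srt} (R : ∀ γ, Var Δ γ → Set (PFlag × Ty γ)) (M : Tm Δ α) :
    Set (PFlag × Ty α) :=
  {q | ∃ (Γ : Env Δ) (f : PFlag), (∀ B ∈ Γ, (B.flag, B.ty) ∈ R B.sort B.var) ∧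
    Nonempty (Deriv Γ M f q.2) ∧ (q.1 = .pr ↔ f = .pr ∨ Env.prod Γ ≠ ∅)}

theorem exists_flag (P : Prop) : ∃ f : PFlag, f = .pr ↔ P := by
  by_cases h : P
  · exact ⟨.pr, by simp [h]⟩
  · exact ⟨.np, by simp [h]⟩

def consTypes {Δ : List Srt} {γ : Srt} (Y : Set (PFlag × Ty γ))
    (R : ∀ γ, Var Δ γ → Set (PFlag × Ty γ)) : ∀ α, Var (γ :: Δ) α → Set (PFlag × Ty α)
  | _, .zero => Y
  | _, .succ x => R _ x

theorem Env.mem_weaken {Δ : List Srt} {γ α : Srt} {Γ : Env Δ} {x : Var (γ :: Δ) α} {f : PFlag}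
    {τ : Ty α} : (⟨x, f, τ⟩ : Binding (γ :: Δ)) ∈ Env.weaken γ Γ ↔
      ∃ y : Var Δ α, x = y.succ ∧ (⟨y, f, τ⟩ : Binding Δ) ∈ Γ := by
  constructor
  · intro h
    obtain ⟨⟨y, g, υ⟩, hB, h⟩ := Finset.mem_image.1 h
    cases h
    exact ⟨y, rfl, hB⟩
  · rintro ⟨y, rfl, h⟩
    exact Finset.mem_image.2 ⟨_, h, rfl⟩

theorem Env.mem_bind_zero {Δ : List Srt} {γ : Srt} {T : Finset (PFlag × Ty γ)} {f : PFlag}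
    {τ : Ty γ} : (⟨.zero, f, τ⟩ : Binding (γ :: Δ)) ∈ Env.bind T ↔ (f, τ) ∈ T := by
  constructor
  · intro h
    obtain ⟨p, hp, h⟩ := Finset.mem_image.1 h
    cases h
    exact hp
  · exact fun h => Finset.mem_image.2 ⟨_, h, rfl⟩

theorem Env.not_succ_mem_bind {Δ : List Srt} {γ α : Srt} {T : Finset (PFlag × Ty γ)} {f : PFlag}
    {x : Var Δ α} {τ : Ty α} : (⟨.succ x, f, τ⟩ : Binding (γ :: Δ)) ∉ Env.bind T := by
  intro h
  obtain ⟨p, hp, h⟩ := Finset.mem_image.1 h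
  cases h

/-- Every environment splits into bindings of the last bound variable and of the others. -/
theorem Env.exists_split {Δ : List Srt} {γ : Srt} (Γ' : Env (γ :: Δ)) :
    ∃ (Γ : Env Δ) (T : Finset (PFlag × Ty γ)), Γ' = Env.weaken γ Γ ∪ Env.bind T := by
  induction Γ' using Finset.induction_on with
  | empty => exact ⟨∅, ∅, rfl⟩
  | insert B Γ' _ ih =>
    obtain ⟨Γ, T, rfl⟩ := ih
    obtain ⟨x, f, τ⟩ := B
    cases x with
    | zero =>
      refine ⟨Γ, insert (f, τ) T, ?_⟩
      rw [Env.bind, Env.bind, Finset.image_insert, Finset.union_insert]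
    | succ x =>
      refine ⟨insert ⟨x, f, τ⟩ Γ, T, ?_⟩
      rw [Env.weaken, Env.weaken, Finset.image_insert, Finset.insert_union]

theorem Env.prod_ne_empty {Δ : List Srt} {Γ : Env Δ} :
    Env.prod Γ ≠ ∅ ↔ ∃ B ∈ Γ, B.flag = .pr := by
  rw [← Finset.nonempty_iff_ne_empty]
  simp [Env.prod, Finset.Nonempty]

/-- Abstraction moves the bindings of the last variable from the environment into `T`. The combined
flag of `typesOf` ignores on which side a productive assumption stands. -/
theorem typesOf_lam {Δ : List Srt} {γ β : Srt} {R : ∀ γ, Var Δ γ → Set (PFlag × Ty γ)}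
    {Y : Set (PFlag × Ty γ)} {K : Tm (γ :: Δ) β} {q : PFlag × Ty β}
    (hq : q ∈ typesOf (consTypes Y R) K) :
    ∃ (f' : PFlag) (T : Finset (PFlag × Ty γ)), (∀ p ∈ T, p ∈ Y) ∧
      (f', Ty.arrow T q.2) ∈ typesOf R (.lam K) ∧ (q.1 = .pr ↔ f' = .pr ∨ ∃ p ∈ T, p.1 = .pr) := by
  obtain ⟨Γ', f, hR, ⟨D⟩, hf⟩ := hq
  obtain ⟨Γ, T, rfl⟩ := Env.exists_split Γ'
  obtain ⟨f', hf'⟩ := exists_flag (f = .pr ∨ Env.prod Γ ≠ ∅)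
  refine ⟨f', T, fun p hp => ?_, ⟨Γ, f, fun B hB => ?_, ⟨.lam rfl D⟩, hf'⟩, ?_⟩
  · exact hR ⟨.zero, p.1, p.2⟩ (Finset.mem_union_right _ (Env.mem_bind_zero.2 hp))
  · exact hR ⟨.succ B.var, B.flag, B.ty⟩
      (Finset.mem_union_left _ (Env.mem_weaken.2 ⟨_, rfl, hB⟩))
  · rw [hf, hf', or_assoc]
    refine or_congr_right ?_
    rw [Env.prod_ne_empty, Env.prod_ne_empty]
    simp [Finset.mem_union, Env.weaken, Env.bind, or_and_right, exists_or]

theorem typesOf_app {Δ : List Srt} {α β : Srt} {R : ∀ γ, Var Δ γ → Set (PFlag × Ty γ)}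
    {K : Tm Δ (.arr α β)} {L : Tm Δ α} {q : PFlag × Ty β} {f' : PFlag}
    {T : Finset (PFlag × Ty α)} (hT : ∀ p ∈ T, p ∈ typesOf R L)
    (hK : (f', Ty.arrow T q.2) ∈ typesOf R K)
    (hq : q.1 = .pr ↔ f' = .pr ∨ ∃ p ∈ T, p.1 = .pr) : q ∈ typesOf R (.app K L) := by
  obtain ⟨Γ, f₀, hR, ⟨DK⟩, hf'⟩ := hK
  have hT' : ∀ i : {p // p ∈ T}, i.1 ∈ typesOf R L := fun i => hT i.1 i.2
  choose Γs fo hRs DL hfo using hT'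
  obtain ⟨f, hf⟩ := exists_flag (f₀ = .pr ∨ (∃ i, fo i = .pr) ∨
    (Env.prod Γ).card + ∑ i, (Env.prod (Γs i)).card
      > (Env.prod (Γ ∪ Finset.univ.biUnion Γs)).card)
  refine ⟨_, f, ?_, ⟨.app DK (fun i => (DL i).some) hfo hf rfl⟩, ?_⟩
  · intro B hB
    rcases Finset.mem_union.1 hB with hB | hB
    · exact hR B hB
    · obtain ⟨i, -, hB⟩ := Finset.mem_biUnion.1 hB
      exact hRs i B hB
  · have hU : Env.prod (Γ ∪ Finset.univ.biUnion Γs) ≠ ∅ ↔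
        Env.prod Γ ≠ ∅ ∨ ∃ i, Env.prod (Γs i) ≠ ∅ := by
      simp only [Env.prod_ne_empty, Finset.mem_union, Finset.mem_biUnion, Finset.mem_univ,
        true_and]
      constructor
      · rintro ⟨B, hB | ⟨i, hB⟩, h⟩
        · exact .inl ⟨B, hB, h⟩
        · exact .inr ⟨i, B, hB, h⟩
      · rintro (⟨B, hB, h⟩ | ⟨i, B, hB, h⟩)
        · exact ⟨B, .inl hB, h⟩
        · exact ⟨B, .inr ⟨i, hB⟩, h⟩
    -- Duplication adds nothing to the combined flag: a duplicated productive binding is already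
    -- present in some environment.
    have hdup : (Env.prod Γ).card + ∑ i, (Env.prod (Γs i)).card
        > (Env.prod (Γ ∪ Finset.univ.biUnion Γs)).card →
        Env.prod Γ ≠ ∅ ∨ ∃ i, Env.prod (Γs i) ≠ ∅ := by
      intro h
      by_contra hc
      push Not at hc
      simp [hc.1, hc.2] at h
    have hTe : (∃ p ∈ T, p.1 = .pr) ↔ ∃ i : {p // p ∈ T}, i.1.1 = .pr := by simp
    have hTe' : (∃ i : {p // p ∈ T}, i.1.1 = .pr) ↔
        (∃ i, fo i = .pr) ∨ ∃ i, Env.prod (Γs i) ≠ ∅ := by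
      rw [← exists_or]
      exact exists_congr hfo
    rw [hq, hTe, hTe', hf', hf, hU]
    clear hU hTe hTe' hq hf' hf hfo
    constructor
    · rintro ((h | h) | h | h)
      exacts [.inl (.inl h), .inr (.inl h), .inl (.inr (.inl h)), .inr (.inr h)]
    · rintro ((h | h | h) | h | h)
      · exact .inl (.inl h)
      · exact .inr (.inl h)
      · exact (hdup h).elim (fun h => .inl (.inr h)) fun h => .inr (.inr h)
      · exact .inl (.inr h)
      · exact .inr (.inr h)

/-- The fundamental lemma: the sets in `Total` are closed under exactly what application does, and
at sort `o` totality means that some judgment is derivable. -/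
theorem total_typesOf {Δ : List Srt} {α : Srt} (M : Tm Δ α)
    (R : ∀ γ, Var Δ γ → Set (PFlag × Ty γ)) (hR : ∀ γ x, Total (R γ x)) :
    Total (typesOf R M) := by
  induction M with
  | a =>
    rintro Y ⟨⟨f, r⟩, hY⟩
    exact ⟨(.pr, Ty.r), .pr, {(f, Ty.r)}, fun p hp => by rw [Finset.mem_singleton.1 hp]; exact hY,
      ⟨∅, .pr, by simp, ⟨.a f⟩, by simp⟩, by simp⟩
  | b =>
    rintro Y ⟨⟨f, r⟩, hY⟩ Y' ⟨⟨f', r'⟩, hY'⟩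
    obtain ⟨g, hg⟩ := exists_flag (f = .pr)
    obtain ⟨g', hg'⟩ := exists_flag (g = .pr ∨ f' = .pr)
    exact ⟨(g', Ty.r), g, {(f', Ty.r)}, fun p hp => by rw [Finset.mem_singleton.1 hp]; exact hY',
      ⟨.np, {(f, Ty.r)}, fun p hp => by rw [Finset.mem_singleton.1 hp]; exact hY, ⟨∅, .np, by simp, ⟨.b f f'⟩, by simp [Env.prod]⟩,
        by simp [hg]⟩, by simp [hg']⟩
  | e => exact ⟨(.np, Ty.r), ∅, .np, by simp, ⟨.e⟩, by simp [Env.prod]⟩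
  | var x =>
    refine (hR _ x).mono fun q hq => ?_
    refine ⟨{⟨x, q.1, q.2⟩}, .np, by simpa using hq, ⟨.var x q.1 q.2⟩, ?_⟩
    rw [Env.prod_ne_empty]
    simp
  | lam K ih =>
    intro Y hY
    refine (ih (consTypes Y R) fun γ x => ?_).mono fun q hq => typesOf_lam hq
    cases x with
    | zero => exact hY
    | succ x => exact hR _ x
  | app K L ihK ihL =>
    refine (ihK R hR _ (ihL R hR)).mono ?_
    rintro q ⟨f', T, hT, hK, hq⟩
    exact typesOf_app hT hK hq

theorem Env.eq_empty_of_closed (Γ : Env []) : Γ = ∅ :=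
  Finset.eq_empty_of_forall_notMem fun B _ => nomatch B.var

theorem exists_deriv (M : Tm [] .o) : ∃ f : PFlag, Nonempty (Deriv ∅ M f Ty.r) := by
  obtain ⟨⟨g, r⟩, Γ, f, -, hD, -⟩ := total_typesOf M (fun _ x => nomatch x) (fun _ x => nomatch x)
  obtain rfl := Env.eq_empty_of_closed Γ
  exact ⟨f, hD⟩

/-! ### Towers indexed by orders -/

/-- A tower of exponentials with `n` levels, the vector `b` giving a weight to each level. -/
def tower : ℕ → (ℕ → ℕ) → ℕ
  | 0, _ => 0
  -- The entry at 0 is a factor, later entries sit in higher exponents. Subtracting one makes the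
  -- zero vector evaluate to zero.
  | n + 1, b => 2 ^ tower n (fun i => b (i + 1)) * (1 + b 0) - 1

theorem tower_succ_add_one (n : ℕ) (b : ℕ → ℕ) :
    tower (n + 1) b + 1 = 2 ^ tower n (fun i => b (i + 1)) * (1 + b 0) :=
  Nat.sub_add_cancel (Nat.mul_pos (by positivity) (by omega))

theorem tower_zero (n : ℕ) : tower n 0 = 0 := by
  induction n with
  | zero => rfl
  | succ n ih =>
    have h := tower_succ_add_one n 0
    rw [show (fun i => (0 : ℕ → ℕ) (i + 1)) = 0 from rfl, ih] at h
    simpa using h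

theorem tower_mono (n : ℕ) {b c : ℕ → ℕ} (h : b ≤ c) : tower n b ≤ tower n c := by
  induction n generalizing b c with
  | zero => exact le_rfl
  | succ n ih =>
    have h1 := tower_succ_add_one n b
    have h2 := tower_succ_add_one n c
    have h3 : 2 ^ tower n (fun i => b (i + 1)) * (1 + b 0) ≤
        2 ^ tower n (fun i => c (i + 1)) * (1 + c 0) :=
      Nat.mul_le_mul (Nat.pow_le_pow_right (by norm_num) (ih fun i => h (i + 1)))
        (Nat.add_le_add_left (h 0) 1)
    omega

theorem tower_add_le (n : ℕ) (b c : ℕ → ℕ) : tower n b + tower n c ≤ tower n (b + c) := by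
  induction n generalizing b c with
  | zero => exact le_rfl
  | succ n ih =>
    have h1 := tower_succ_add_one n b
    have h2 := tower_succ_add_one n c
    have h3 := tower_succ_add_one n (b + c)
    have h4 : 2 ^ tower n (fun i => b (i + 1)) * 2 ^ tower n (fun i => c (i + 1)) ≤
        2 ^ tower n (fun i => (b + c) (i + 1)) := by
      rw [← pow_add]
      exact Nat.pow_le_pow_right (by norm_num) (ih _ _)
    have h5 : 1 ≤ 2 ^ tower n (fun i => b (i + 1)) := Nat.one_le_two_pow
    have h6 : 1 ≤ 2 ^ tower n (fun i => c (i + 1)) := Nat.one_le_two_pow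
    have h7 : (b + c) 0 = b 0 + c 0 := rfl
    rw [h7] at h3
    generalize 2 ^ tower n (fun i => b (i + 1)) = x at *
    generalize 2 ^ tower n (fun i => c (i + 1)) = y at *
    generalize 2 ^ tower n (fun i => (b + c) (i + 1)) = z at *
    have h8 : x * y * (1 + (b 0 + c 0)) ≤ z * (1 + (b 0 + c 0)) := Nat.mul_le_mul_right _ h4
    -- The difference of the two sides is `(x-1)(y-1) + x(y-1)·b 0 + y(x-1)·c 0`.
    have h9 : x * (1 + b 0) + y * (1 + c 0) ≤ x * y * (1 + (b 0 + c 0)) + 1 := by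
      obtain ⟨x, rfl⟩ := Nat.exists_eq_add_of_le h5
      obtain ⟨y, rfl⟩ := Nat.exists_eq_add_of_le h6
      nlinarith [Nat.zero_le (x * y), Nat.zero_le (x * y * b 0), Nat.zero_le (x * y * c 0),
        Nat.zero_le (y * b 0), Nat.zero_le (x * c 0)]
    omega

theorem tower_add_single_zero (n : ℕ) (b : ℕ → ℕ) :
    tower (n + 1) b + 1 ≤ tower (n + 1) (b + Pi.single 0 1) := by
  have h1 := tower_succ_add_one n b
  have h2 := tower_succ_add_one n (b + Pi.single 0 1)
  have h3 : (fun i => (b + Pi.single 0 1 : ℕ → ℕ) (i + 1)) = fun i => b (i + 1) := by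
    funext i
    simp
  have h4 : (b + Pi.single 0 1 : ℕ → ℕ) 0 = b 0 + 1 := by simp
  rw [h3, h4] at h2
  have h5 : 1 ≤ 2 ^ tower n (fun i => b (i + 1)) := Nat.one_le_two_pow
  nlinarith

/-- Doubling a weight on the levels up to `j` costs at most one on the level `j + 1`. -/
theorem tower_double (n j : ℕ) (hj : j + 1 < n) (a b : ℕ → ℕ) (ha : ∀ i, j < i → a i = 0) :
    tower n (b + (a + a)) + 1 ≤ tower n (b + (a + Pi.single (j + 1) 1)) := by
  induction j generalizing n a b with
  | zero =>
    obtain ⟨n, rfl⟩ : ∃ k, n = k + 2 := ⟨n - 2, by omega⟩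
    have h1 := tower_succ_add_one (n + 1) (b + (a + a))
    have h2 := tower_succ_add_one (n + 1) (b + (a + Pi.single 1 1))
    have h3 : (fun i => (b + (a + a)) (i + 1)) = fun i => b (i + 1) := by
      funext i
      simp [ha]
    have h4 : (fun i => (b + (a + Pi.single 1 1) : ℕ → ℕ) (i + 1)) =
        (fun i => b (i + 1)) + Pi.single 0 1 := by
      funext i
      cases i <;> simp [ha]
    have h5 := tower_add_single_zero n (fun i => b (i + 1))
    have h6 : (b + (a + Pi.single 1 1) : ℕ → ℕ) 0 = b 0 + a 0 := by simp
    have h7 : (b + (a + a)) 0 = b 0 + (a 0 + a 0) := rfl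
    rw [h3, h7] at h1
    rw [h4, h6] at h2
    have h8 := Nat.pow_le_pow_right (n := 2) (by norm_num) h5
    rw [pow_succ] at h8
    have h9 : 1 ≤ 2 ^ tower (n + 1) (fun i => b (i + 1)) := Nat.one_le_two_pow
    have h10 := Nat.mul_le_mul_right (1 + (b 0 + a 0)) h8
    rw [show (0 + 1 : ℕ) = 1 from rfl]
    nlinarith [Nat.zero_le (2 ^ tower (n + 1) (fun i => b (i + 1)) * b 0)]
  | succ j ih =>
    obtain ⟨n, rfl⟩ : ∃ k, n = k + 1 := ⟨n - 1, by omega⟩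
    have h1 := tower_succ_add_one n (b + (a + a))
    have h2 := tower_succ_add_one n (b + (a + Pi.single (j + 1 + 1) 1))
    have h4 : (fun i => (b + (a + Pi.single (j + 1 + 1) 1) : ℕ → ℕ) (i + 1)) =
        (fun i => b (i + 1)) + ((fun i => a (i + 1)) + Pi.single (j + 1) 1) := by
      funext i
      simp [Pi.single_apply]
    have h5 := ih n (by omega) (fun i => a (i + 1)) (fun i => b (i + 1))
      (fun i hi => ha _ (by omega))
    have h6 : (b + (a + Pi.single (j + 1 + 1) 1) : ℕ → ℕ) 0 = b 0 + a 0 := by simp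
    have h7 : (b + (a + a)) 0 = b 0 + (a 0 + a 0) := rfl
    rw [show (fun i => (b + (a + a)) (i + 1)) = (fun i => b (i + 1)) +
      ((fun i => a (i + 1)) + (fun i => a (i + 1))) from rfl, h7] at h1
    rw [h4, h6] at h2
    -- The `+ 1` of the induction hypothesis becomes a factor 2 here, which pays for doubling `a 0`
    -- and leaves the `+ 1` needed again.
    have h8 := Nat.pow_le_pow_right (n := 2) (by norm_num) h5
    rw [pow_succ] at h8
    have h9 : 1 ≤ 2 ^ tower n ((fun i => b (i + 1)) +
      ((fun i => a (i + 1)) + (fun i => a (i + 1)))) := Nat.one_le_two_pow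
    have h10 := Nat.mul_le_mul_right (1 + (b 0 + a 0)) h8
    generalize 2 ^ tower n ((fun i => b (i + 1)) +
      ((fun i => a (i + 1)) + (fun i => a (i + 1)))) = x at *
    nlinarith [Nat.zero_le (x * b 0)]

/-- Evaluate the levels from `j` on of an `n`-level tower and store the result at level `j`. -/
def collapse : ℕ → ℕ → (ℕ → ℕ) → ℕ → ℕ
  | 0, n, b => Pi.single 0 (tower n b)
  | j + 1, n, b => fun i => Nat.casesOn i (b 0) (collapse j (n - 1) (fun i => b (i + 1)))

theorem collapse_eq_zero_of_lt {j n : ℕ} {b : ℕ → ℕ} {i : ℕ} (h : j < i) :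
    collapse j n b i = 0 := by
  induction j generalizing n b i with
  | zero => simp [collapse, h.ne']
  | succ j ih =>
    obtain ⟨i, rfl⟩ : ∃ k, i = k + 1 := ⟨i - 1, by omega⟩
    exact ih (by omega)

theorem collapse_zero (j n : ℕ) : collapse j n 0 = 0 := by
  induction j generalizing n with
  | zero => simp [collapse, tower_zero]
  | succ j ih =>
    funext i
    cases i with
    | zero => rfl
    | succ i => exact congrFun (ih (n - 1)) i

theorem collapse_add (j n : ℕ) (b a : ℕ → ℕ) (ha : ∀ i, j ≤ i → a i = 0) :
    collapse j n (b + a) = collapse j n b + a := by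
  induction j generalizing n a b with
  | zero =>
    obtain rfl : a = 0 := funext fun i => ha i (Nat.zero_le i)
    simp
  | succ j ih =>
    funext i
    cases i with
    | zero => rfl
    | succ i =>
      exact congrFun (ih (n - 1) (fun i => b (i + 1)) (fun i => a (i + 1))
        (fun i hi => ha _ (by omega))) i

theorem tower_collapse (j n : ℕ) (b : ℕ → ℕ) : tower n (collapse j n b) = tower n b := by
  induction j generalizing n b with
  | zero =>
    cases n with
    | zero => rfl
    | succ n =>
      have h1 := tower_succ_add_one n (collapse 0 (n + 1) b)
      have h2 : (fun i => collapse 0 (n + 1) b (i + 1)) = 0 := by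
        funext i
        exact collapse_eq_zero_of_lt (Nat.succ_pos i)
      have h3 : collapse 0 (n + 1) b 0 = tower (n + 1) b := by simp [collapse]
      rw [h2, h3, tower_zero] at h1
      omega
  | succ j ih =>
    cases n with
    | zero => rfl
    | succ n =>
      have h1 := tower_succ_add_one n (collapse (j + 1) (n + 1) b)
      have h2 := tower_succ_add_one n b
      rw [show (fun i => collapse (j + 1) (n + 1) b (i + 1)) =
        collapse j n (fun i => b (i + 1)) from rfl, ih n,
        show collapse (j + 1) (n + 1) b 0 = b 0 from rfl] at h1
      omega

/-- Evaluating the upper levels of `b` early forgoes their interaction with `c`; by superadditivity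
of `tower` in the exponent this can only lower the result. -/
theorem tower_add_collapse_le (j n : ℕ) (c b : ℕ → ℕ) :
    tower n (c + collapse j n b) ≤ tower n (c + b) := by
  induction j generalizing n c b with
  | zero =>
    cases n with
    | zero => exact le_rfl
    | succ n =>
      have h1 := tower_succ_add_one n (c + collapse 0 (n + 1) b)
      have h2 := tower_succ_add_one n (c + b)
      have h3 := tower_succ_add_one n b
      have h4 : (fun i => (c + collapse 0 (n + 1) b) (i + 1)) = fun i => c (i + 1) := by
        funext i
        simp [collapse_eq_zero_of_lt (Nat.succ_pos i)]
      have h5 : (c + collapse 0 (n + 1) b) 0 = c 0 + tower (n + 1) b := by simp [collapse]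
      have h6 : (c + b) 0 = c 0 + b 0 := rfl
      have h7 : 2 ^ tower n (fun i => c (i + 1)) * 2 ^ tower n (fun i => b (i + 1)) ≤
          2 ^ tower n (fun i => (c + b) (i + 1)) := by
        rw [← pow_add]
        exact Nat.pow_le_pow_right (by norm_num) (tower_add_le _ _ _)
      have h8 : 1 ≤ 2 ^ tower n (fun i => b (i + 1)) := Nat.one_le_two_pow
      rw [h4, h5] at h1
      rw [h6] at h2
      generalize 2 ^ tower n (fun i => c (i + 1)) = x at *
      generalize 2 ^ tower n (fun i => b (i + 1)) = y at *
      generalize 2 ^ tower n (fun i => (c + b) (i + 1)) = z at *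
      have h9 := Nat.mul_le_mul_right (1 + (c 0 + b 0)) h7
      have h10 : 1 + (c 0 + tower (n + 1) b) = c 0 + y * (1 + b 0) := by omega
      rw [h10] at h1
      have h11 : x * (c 0 + y * (1 + b 0)) ≤ x * y * (1 + (c 0 + b 0)) := by
        have : x * c 0 ≤ x * c 0 * y := Nat.le_mul_of_pos_right _ h8
        nlinarith
      omega
  | succ j ih =>
    cases n with
    | zero => exact le_rfl
    | succ n =>
      have h1 := tower_succ_add_one n (c + collapse (j + 1) (n + 1) b)
      have h2 := tower_succ_add_one n (c + b)
      have h3 := Nat.pow_le_pow_right (n := 2) (by norm_num)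
        (ih n (fun i => c (i + 1)) (fun i => b (i + 1)))
      have h4 := Nat.mul_le_mul_right (1 + (c 0 + b 0)) h3
      have h1' : tower (n + 1) (c + collapse (j + 1) (n + 1) b) + 1 =
        2 ^ tower n ((fun i => c (i + 1)) + collapse j n (fun i => b (i + 1))) *
          (1 + (c 0 + b 0)) := h1
      have h2' : tower (n + 1) (c + b) + 1 =
        2 ^ tower n ((fun i => c (i + 1)) + (fun i => b (i + 1))) * (1 + (c 0 + b 0)) := h2
      omega

/-- `b` is dominated by `c` in all additive contexts. -/
def Dom (n : ℕ) (b c : ℕ → ℕ) : Prop := ∀ d, tower n (d + b) ≤ tower n (d + c)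

theorem Dom.refl (n : ℕ) (b : ℕ → ℕ) : Dom n b b := fun _ => le_rfl

theorem Dom.trans {n : ℕ} {b c d : ℕ → ℕ} (h : Dom n b c) (h' : Dom n c d) : Dom n b d :=
  fun x => (h x).trans (h' x)

theorem Dom.add_right {n : ℕ} {b c : ℕ → ℕ} (h : Dom n b c) (a : ℕ → ℕ) :
    Dom n (b + a) (c + a) := fun x => by
  simpa only [add_assoc, add_comm a] using h (x + a)

theorem Dom.add {n : ℕ} {b c b' c' : ℕ → ℕ} (h : Dom n b c) (h' : Dom n b' c') :
    Dom n (b + b') (c + c') := by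
  refine (h.add_right b').trans ?_
  rw [add_comm c, add_comm c]
  exact h'.add_right c

theorem Dom.sum {n : ℕ} {ι : Type} (s : Finset ι) {b c : ι → ℕ → ℕ}
    (h : ∀ i ∈ s, Dom n (b i) (c i)) : Dom n (∑ i ∈ s, b i) (∑ i ∈ s, c i) := by
  classical
  induction s using Finset.induction_on with
  | empty => exact .refl _ _
  | insert i s hi ih =>
    rw [Finset.sum_insert hi, Finset.sum_insert hi]
    exact (h i (Finset.mem_insert_self _ _)).add
      (ih fun k hk => h k (Finset.mem_insert_of_mem hk))

theorem dom_collapse (j n : ℕ) (b : ℕ → ℕ) : Dom n (collapse j n b) b :=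
  fun d => tower_add_collapse_le j n d b

theorem dom_nsmul {n j : ℕ} (hj : j + 1 < n) {a : ℕ → ℕ} (ha : ∀ i, j < i → a i = 0) (k : ℕ) :
    Dom n ((k + 1) • a) (a + k • Pi.single (j + 1) 1) := by
  induction k with
  | zero => simpa using Dom.refl n a
  | succ k ih =>
    rw [succ_nsmul, succ_nsmul (Pi.single (j + 1) 1 : ℕ → ℕ)]
    refine (ih.add_right a).trans ?_
    have h : Dom n (a + a) (a + Pi.single (j + 1) 1) :=
      fun d => (Nat.le_succ _).trans (tower_double n j hj a d ha)
    have := h.add_right (k • Pi.single (j + 1) 1)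
    convert this using 1 <;> abel

/-! ### Bookkeeping for derivations -/

/-- The conditions making an application productive say precisely that one of the summands of its
value is positive. -/
theorem Deriv.flag_iff {Δ : List Srt} {α : Srt} {Γ : Env Δ} {M : Tm Δ α} {f : PFlag} {τ : Ty α}
    (D : Deriv Γ M f τ) : f = .pr ↔ 0 < D.val := by
  induction D with
  | a f => simp [Deriv.val]
  | b f₁ f₂ => simp [Deriv.val]
  | e => simp [Deriv.val]
  | var x f τ => simp [Deriv.val]
  | lam hΓ' D ih => exact ih
  | app DK DL hT hf hΘ ihK ihL =>
    rw [hf, ihK]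
    simp only [ihL, Deriv.val, Env.dup, Nat.add_pos_iff_pos_or_pos, tsub_pos_iff_lt,
      Finset.sum_pos_iff, Finset.mem_univ, true_and, gt_iff_lt]
    rw [or_comm, or_assoc, or_comm, or_assoc]

section Multiplicity

variable {Δ : List Srt} {ι : Type} [Fintype ι] (Γ : Env Δ) (Γs : ι → Env Δ)

/-- The number of environments among `Γ` and `Γs i` that contain a binding. -/
def Env.mult (B : Binding Δ) : ℕ :=
  (if B ∈ Γ then 1 else 0) + ∑ i, if B ∈ Γs i then 1 else 0

theorem Env.one_le_mult {B : Binding Δ} (hB : B ∈ Γ ∪ Finset.univ.biUnion Γs) :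
    1 ≤ Env.mult Γ Γs B := by
  unfold Env.mult
  rcases Finset.mem_union.1 hB with h | h
  · simp [h]
  · obtain ⟨i, -, h⟩ := Finset.mem_biUnion.1 h
    have := Finset.single_le_sum (f := fun i => if B ∈ Γs i then 1 else 0)
      (fun i _ => Nat.zero_le _) (Finset.mem_univ i)
    simp only [h, if_true] at this
    omega

/-- Double counting; it turns the weights used by the premises into multiplicities over the
environment of the conclusion. -/
theorem Env.sum_mult {X : Type} [AddCommMonoid X] (g : Binding Δ → X) :
    ∑ B ∈ Γ, g B + ∑ i, ∑ B ∈ Γs i, g B =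
      ∑ B ∈ Γ ∪ Finset.univ.biUnion Γs, Env.mult Γ Γs B • g B := by
  have key : ∀ Ξ : Env Δ, Ξ ⊆ Γ ∪ Finset.univ.biUnion Γs →
      ∑ B ∈ Ξ, g B = ∑ B ∈ Γ ∪ Finset.univ.biUnion Γs, (if B ∈ Ξ then 1 else 0) • g B := by
    intro Ξ h
    rw [← Finset.sum_subset h]
    · exact Finset.sum_congr rfl fun B hB => by simp [hB]
    · intro B _ hB
      simp [hB]
  rw [key Γ Finset.subset_union_left, Finset.sum_congr rfl fun i _ => key (Γs i)
    ((Finset.subset_biUnion_of_mem Γs (Finset.mem_univ i)).trans Finset.subset_union_right),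
    Finset.sum_comm, ← Finset.sum_add_distrib]
  refine Finset.sum_congr rfl fun B _ => ?_
  rw [Env.mult, add_smul, Finset.sum_smul]

theorem Env.card_prod (Ξ : Env Δ) :
    (Env.prod Ξ).card = ∑ B ∈ Ξ, if B.flag = .pr then 1 else 0 := by
  rw [Env.prod, Finset.card_filter]

theorem Env.dup_eq_sum : Env.dup Γ Γs =
    ∑ B ∈ Γ ∪ Finset.univ.biUnion Γs, if B.flag = .pr then Env.mult Γ Γs B - 1 else 0 := by
  simp only [Env.dup, Env.card_prod]
  rw [Env.sum_mult, ← Finset.sum_tsub_distrib]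
  · refine Finset.sum_congr rfl fun B _ => ?_
    split_ifs <;> simp
  · intro B hB
    have := Env.one_le_mult Γ Γs hB
    split_ifs <;> simp [this]

end Multiplicity

/-- Weights for the bindings of a context with one more variable. -/
def Binding.cases {X : Type} {Δ : List Srt} {γ : Srt} (aT : PFlag × Ty γ → X)
    (a : Binding Δ → X) : Binding (γ :: Δ) → X
  | ⟨.zero, f, τ⟩ => aT (f, τ)
  | ⟨.succ x, f, τ⟩ => a ⟨x, f, τ⟩

theorem Binding.sum_cases {X : Type} [AddCommMonoid X] {Δ : List Srt} {γ : Srt}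
    (aT : PFlag × Ty γ → X) (a : Binding Δ → X) (Γ : Env Δ) (T : Finset (PFlag × Ty γ)) :
    ∑ B ∈ Env.weaken γ Γ ∪ Env.bind T, Binding.cases aT a B = ∑ B ∈ Γ, a B + ∑ p ∈ T, aT p := by
  rw [Finset.sum_union, Env.weaken, Env.bind, Finset.sum_image, Finset.sum_image]
  · rfl
  · rintro ⟨f, τ⟩ _ ⟨f', τ'⟩ _ h
    cases h
    rfl
  · rintro ⟨x, f, τ⟩ _ ⟨x', f', τ'⟩ _ h
    cases h
    rfl
  · rw [Finset.disjoint_left]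
    intro B hB hB'
    obtain ⟨⟨x, f, τ⟩, _, rfl⟩ := Finset.mem_image.1 hB
    exact Env.not_succ_mem_bind hB'

theorem Binding.forall_cases {Δ : List Srt} {γ : Srt} {Γ : Env Δ} {T : Finset (PFlag × Ty γ)}
    {P : Binding (γ :: Δ) → Prop} (hT : ∀ p ∈ T, P ⟨.zero, p.1, p.2⟩)
    (hΓ : ∀ B ∈ Γ, P ⟨.succ B.var, B.flag, B.ty⟩) : ∀ B ∈ Env.weaken γ Γ ∪ Env.bind T, P B := by
  intro B hB
  rcases Finset.mem_union.1 hB with hB | hB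
  · obtain ⟨B, h, rfl⟩ := Finset.mem_image.1 hB
    exact hΓ B h
  · obtain ⟨p, h, rfl⟩ := Finset.mem_image.1 hB
    exact hT p h

/-- Extension by zero of a family indexed by a finite set. -/
def extendZero {X P : Type} [Zero X] [DecidableEq P] (T : Finset P) (φ : {p // p ∈ T} → X)
    (p : P) : X :=
  if h : p ∈ T then φ ⟨p, h⟩ else 0

theorem extendZero_coe {X P : Type} [Zero X] [DecidableEq P] {T : Finset P}
    (φ : {p // p ∈ T} → X) (i : {p // p ∈ T}) : extendZero T φ i.1 = φ i :=
  dif_pos i.2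

theorem sum_extendZero {X P : Type} [AddCommMonoid X] [DecidableEq P] (T : Finset P)
    (φ : {p // p ∈ T} → X) : ∑ p ∈ T, extendZero T φ p = ∑ i, φ i := by
  rw [← Finset.sum_coe_sort]
  exact Finset.sum_congr rfl fun i _ => extendZero_coe φ i

theorem PFlag.eq_np_iff {f : PFlag} : f = .np ↔ f ≠ .pr := by
  cases f <;> simp

/-- The argument of an application has no value and no productive assumptions if it is used
nonproductively. -/
theorem Deriv.of_np {Δ : List Srt} {α : Srt} {Γ : Env Δ} {M : Tm Δ α} {f g : PFlag} {τ : Ty α}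
    (D : Deriv Γ M f τ) (h : g = .pr ↔ f = .pr ∨ Env.prod Γ ≠ ∅) (hg : g = .np) :
    D.val = 0 ∧ ∀ B ∈ Γ, B.flag = .np := by
  rw [PFlag.eq_np_iff, Ne, h, D.flag_iff, Env.prod_ne_empty] at hg
  push Not at hg
  exact ⟨by omega, fun B hB => PFlag.eq_np_iff.2 (hg.2 B hB)⟩

/-! ### The lower bound -/

/-- `Lower τ d w`: at the type `τ`, the element `d` produces at least `w`. -/
def Lower : {α : Srt} → Ty α → Sem ℕ α → ℕ → Prop
  | .o, _, d, w => w ≤ (show ℕ from d)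
  -- Weight at least one on productive pairs makes each duplication gain at least one.
  | .arr α _, (T, τ), d, w => ∀ (x : Sem ℕ α) (a : PFlag × Ty α → ℕ),
      (∀ p ∈ T, (p.1 = .pr → 1 ≤ a p) ∧ (p.1 = .np → a p = 0) ∧ Lower p.2 x (a p)) →
      Lower τ (d x) (w + ∑ p ∈ T, a p)

theorem Lower.mono {α : Srt} {τ : Ty α} {d : Sem ℕ α} {w w' : ℕ} (h : Lower τ d w)
    (hw : w' ≤ w) : Lower τ d w' := by
  induction α generalizing w w' with
  | o => exact hw.trans h
  | arr α β _ ih => exact fun x a ha => ih (h x a ha) (by gcongr)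

theorem lower_eval {Δ : List Srt} {α : Srt} {Γ : Env Δ} {M : Tm Δ α} {f : PFlag} {τ : Ty α}
    (D : Deriv Γ M f τ) (ρ : Valn ℕ Δ) (a : Binding Δ → ℕ)
    (ha : ∀ B ∈ Γ, (B.flag = .pr → 1 ≤ a B) ∧ (B.flag = .np → a B = 0) ∧
      Lower B.ty (ρ _ B.var) (a B)) :
    Lower τ (M.eval countAlg ρ) (∑ B ∈ Γ, a B + D.val) := by
  induction D with
  | a f =>
    intro x w hw
    have h : w (f, Ty.r) ≤ (show ℕ from x) := (hw _ (Finset.mem_singleton_self _)).2.2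
    change 0 + 1 + ∑ p ∈ {(f, Ty.r)}, w p ≤ (show ℕ from x) + 1
    rw [Finset.sum_singleton]
    omega
  | b f₁ f₂ =>
    intro x w hw y v hv
    have h : w (f₁, Ty.r) ≤ (show ℕ from x) := (hw _ (Finset.mem_singleton_self _)).2.2
    have h' : v (f₂, Ty.r) ≤ (show ℕ from y) := (hv _ (Finset.mem_singleton_self _)).2.2
    change 0 + 0 + ∑ p ∈ {(f₁, Ty.r)}, w p + ∑ p ∈ {(f₂, Ty.r)}, v p ≤
      (show ℕ from x) + (show ℕ from y)
    rw [Finset.sum_singleton, Finset.sum_singleton]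
    omega
  | e => exact le_rfl
  | var x f τ =>
    rw [Finset.sum_singleton]
    exact (ha _ (Finset.mem_singleton_self _)).2.2
  | @lam Δ α β K Γ Γ' T f τ hΓ' D ih =>
    intro x w hw
    subst hΓ'
    have h := ih (ρ.cons x) (Binding.cases w a) (Binding.forall_cases hw ha)
    rw [Binding.sum_cases] at h
    rw [add_right_comm]
    exact h
  | @app Δ α β K L Γ Θ T τ f f' Γs fo DK DL hT hf hΘ ihK ihL =>
    subst hΘ
    have haK := fun B hB => ha B (Finset.mem_union_left _ hB)
    have haL : ∀ i, ∀ B ∈ Γs i, _ := fun i B hB => ha B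
      (Finset.mem_union_right _ (Finset.mem_biUnion.2 ⟨i, Finset.mem_univ i, hB⟩))
    have h := ihK ρ a haK (L.eval countAlg ρ)
      (extendZero T fun i => ∑ B ∈ Γs i, a B + (DL i).val) fun p hp => by
        lift p to {p // p ∈ T} using hp with i
        rw [extendZero_coe]
        refine ⟨fun hi => ?_, fun hi => ?_, ihL i ρ a (haL i)⟩
        · rw [hT, (DL i).flag_iff, Env.prod_ne_empty] at hi
          rcases hi with hi | ⟨B, hB, hi⟩
          · omega
          · have := Finset.single_le_sum (f := a) (fun _ _ => Nat.zero_le _) hB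
            have := (haL i B hB).1 hi
            omega
        · obtain ⟨h0, h1⟩ := (DL i).of_np (hT i) hi
          rw [h0, Finset.sum_eq_zero fun B hB => (haL i B hB).2.1 (h1 B hB)]
    refine h.mono ?_
    rw [sum_extendZero, Finset.sum_add_distrib]
    have h1 := Env.sum_mult Γ Γs a
    have h2 : ∑ B ∈ Γ ∪ Finset.univ.biUnion Γs, a B + Env.dup Γ Γs ≤
        ∑ B ∈ Γ ∪ Finset.univ.biUnion Γs, Env.mult Γ Γs B • a B := by
      rw [Env.dup_eq_sum, ← Finset.sum_add_distrib]
      refine Finset.sum_le_sum fun B hB => ?_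
      -- For a productive binding `a B ≥ 1`, so `(1 + k) * a B ≥ a B + k`, and `k` is its share of
      -- `Env.dup`.
      obtain ⟨k, hk⟩ := Nat.exists_eq_add_of_le (Env.one_le_mult Γ Γs hB)
      rw [hk, smul_eq_mul]
      split_ifs with hp
      · have := (ha B hB).1 hp
        rw [Nat.add_sub_cancel_left]
        nlinarith
      · nlinarith
    simp only [Deriv.val]
    omega

theorem Deriv.val_le_eval {M : Tm [] .o} {f : PFlag} {τ : Ty .o} (D : Deriv ∅ M f τ) :
    D.val ≤ M.eval countAlg Valn.nil := by
  have h : 0 + D.val ≤ M.eval countAlg Valn.nil :=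
    lower_eval D Valn.nil (fun _ => 0) (by simp)
  omega

/-! ### The upper bound -/

/-- `Upper n τ d b`: at the type `τ`, the element `d` produces at most what the vector `b` of
weights, evaluated by the tower with `n` levels, allows. -/
def Upper (n : ℕ) : {α : Srt} → Ty α → Sem ℕ α → (ℕ → ℕ) → Prop
  | .o, _, d, b => (show ℕ from d) ≤ tower n b
  -- Argument weights stay on levels up to the order of the argument, which is what `tower_double`
  -- requires of a duplicated binding.
  | .arr α _, (T, τ), d, b => ∀ (x : Sem ℕ α) (a : PFlag × Ty α → ℕ → ℕ),
      (∀ p ∈ T, (∀ i, α.ord < i → a p i = 0) ∧ (p.1 = .np → a p = 0) ∧ Upper n p.2 x (a p)) →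
      Upper n τ (d x) (b + ∑ p ∈ T, a p)

theorem Upper.dom {n : ℕ} {α : Srt} {τ : Ty α} {d : Sem ℕ α} {b c : ℕ → ℕ} (h : Upper n τ d b)
    (hbc : Dom n b c) : Upper n τ d c := by
  induction α generalizing b c with
  | o =>
    have := hbc 0
    rw [zero_add, zero_add] at this
    exact le_trans h this
  | arr α β _ ih => exact fun x a ha => ih (h x a ha) (hbc.add_right _)

/-- The arguments of an element of order at most `j` have order below `j`, so the weights they add
avoid the collapsed levels; at sort `o` collapsing preserves the value of the tower. -/
theorem Upper.collapse {n j : ℕ} {α : Srt} {τ : Ty α} {d : Sem ℕ α} {b : ℕ → ℕ}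
    (h : Upper n τ d b) (hj : α.ord ≤ j) : Upper n τ d (collapse j n b) := by
  induction α generalizing b with
  | o => exact le_of_le_of_eq h (tower_collapse j n b).symm
  | arr α β _ ih =>
    rw [Srt.ord, max_le_iff] at hj
    intro x a ha
    rw [← collapse_add]
    · exact ih (h x a ha) hj.2
    · intro i hi
      rw [Finset.sum_apply]
      exact Finset.sum_eq_zero fun p hp => (ha p hp).1 i (by omega)

/-- The vector `c` is fixed before the valuation and the weights. Bounding each of its entries by
the value makes the final estimate depend on the value alone, and forces `c = 0` when the value is
zero. -/
theorem exists_upper_eval {n : ℕ} {Δ : List Srt} {α : Srt} {Γ : Env Δ} {M : Tm Δ α} {f : PFlag}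
    {τ : Ty α} (D : Deriv Γ M f τ) (hM : M.complexity < n)
    (hΔ : ∀ γ, Var Δ γ → γ.ord + 1 < n) :
    ∃ c : ℕ → ℕ, (∀ j, c j ≤ D.val) ∧ ∀ (ρ : Valn ℕ Δ) (a : Binding Δ → ℕ → ℕ),
      (∀ B ∈ Γ, (∀ i, B.sort.ord < i → a B i = 0) ∧ (B.flag = .np → a B = 0) ∧
        Upper n B.ty (ρ _ B.var) (a B)) →
      Upper n τ (M.eval countAlg ρ) (∑ B ∈ Γ, a B + c) := by
  obtain ⟨k, rfl⟩ : ∃ k, n = k + 1 := ⟨n - 1, by omega⟩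
  induction D with
  | a f =>
    refine ⟨Pi.single 0 1, fun j => ?_, fun ρ _ _ x w hw => ?_⟩
    · rw [Pi.single_apply, Deriv.val]
      split_ifs <;> omega
    · have h : (show ℕ from x) ≤ tower (k + 1) (w (f, Ty.r)) :=
        (hw _ (Finset.mem_singleton_self _)).2.2
      change (show ℕ from x) + 1 ≤ tower (k + 1) (0 + Pi.single 0 1 + ∑ p ∈ {(f, Ty.r)}, w p)
      rw [Finset.sum_singleton, zero_add, add_comm (Pi.single _ _)]
      exact (Nat.add_le_add_right h 1).trans (tower_add_single_zero k _)
  | b f₁ f₂ =>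
    refine ⟨0, fun j => Nat.zero_le _, fun ρ _ _ x w hw y v hv => ?_⟩
    have h : (show ℕ from x) ≤ tower (k + 1) (w (f₁, Ty.r)) :=
      (hw _ (Finset.mem_singleton_self _)).2.2
    have h' : (show ℕ from y) ≤ tower (k + 1) (v (f₂, Ty.r)) :=
      (hv _ (Finset.mem_singleton_self _)).2.2
    change (show ℕ from x) + (show ℕ from y) ≤
      tower (k + 1) (0 + 0 + ∑ p ∈ {(f₁, Ty.r)}, w p + ∑ p ∈ {(f₂, Ty.r)}, v p)
    rw [Finset.sum_singleton, Finset.sum_singleton, zero_add, zero_add]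
    exact (Nat.add_le_add h h').trans (tower_add_le _ _ _)
  | e => exact ⟨0, fun j => Nat.zero_le _, fun ρ _ _ => Nat.zero_le _⟩
  | var x f τ =>
    refine ⟨0, fun j => Nat.zero_le _, fun ρ a ha => ?_⟩
    rw [Finset.sum_singleton, add_zero]
    exact (ha _ (Finset.mem_singleton_self _)).2.2
  | @lam Δ α β K Γ Γ' T f τ hΓ' D ih =>
    subst hΓ'
    -- The sort of an abstraction has order at least one more than its variable, so the tower has a
    -- level to pay for duplicating that variable.
    rw [Tm.complexity, max_lt_iff, Srt.ord, max_lt_iff] at hM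
    obtain ⟨c, hc, h⟩ := ih hM.2 fun γ x => by
      cases x with
      | zero => omega
      | succ x => exact hΔ _ x
    refine ⟨c, hc, fun ρ a ha x w hw => ?_⟩
    have h := h (ρ.cons x) (Binding.cases w a) (Binding.forall_cases hw ha)
    rw [Binding.sum_cases] at h
    rw [add_right_comm]
    exact h
  | @app Δ α β K L Γ Θ T τ f f' Γs fo DK DL hT hf hΘ ihK ihL =>
    subst hΘ
    rw [Tm.complexity, max_lt_iff, max_lt_iff] at hM
    obtain ⟨cK, hcK, hK⟩ := ihK hM.2.1 hΔ
    choose cL hcL hL using fun i => ihL i hM.2.2 hΔ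
    -- One unit at level `ord + 1` for every extra copy of a productive binding; together these
    -- units are the duplication term of the value.
    refine ⟨cK + ∑ i, cL i + ∑ B ∈ Γ ∪ Finset.univ.biUnion Γs,
      (if B.flag = .pr then Env.mult Γ Γs B - 1 else 0) • Pi.single (B.sort.ord + 1) 1,
      fun j => ?_, fun ρ a ha => ?_⟩
    · rw [Deriv.val, Env.dup_eq_sum, Pi.add_apply, Pi.add_apply, Finset.sum_apply,
        Finset.sum_apply, add_comm]
      refine Nat.add_le_add (Finset.sum_le_sum fun B _ => ?_)
        (Nat.add_le_add (hcK j) (Finset.sum_le_sum fun i _ => hcL i j))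
      rw [Pi.smul_apply, Pi.single_apply, smul_eq_mul]
      split_ifs <;> simp
    · have haK := fun B hB => ha B (Finset.mem_union_left _ hB)
      have haL : ∀ i, ∀ B ∈ Γs i, _ := fun i B hB => ha B
        (Finset.mem_union_right _ (Finset.mem_biUnion.2 ⟨i, Finset.mem_univ i, hB⟩))
      have h := hK ρ a haK (L.eval countAlg ρ)
        -- The weight found for the argument may reach levels above `α.ord`; collapsing makes it
        -- admissible in `Upper`, and `dom_collapse` undoes this below.
        (extendZero T fun i => collapse α.ord (k + 1) (∑ B ∈ Γs i, a B + cL i)) fun p hp => by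
          lift p to {p // p ∈ T} using hp with i
          rw [extendZero_coe]
          refine ⟨fun _ => collapse_eq_zero_of_lt, fun hi => ?_,
            (hL i ρ a (haL i)).collapse le_rfl⟩
          obtain ⟨h0, h1⟩ := (DL i).of_np (hT i) hi
          have h2 : cL i = 0 := funext fun j => Nat.le_zero.1 (h0 ▸ hcL i j)
          rw [h2, Finset.sum_eq_zero fun B hB => (haL i B hB).2.1 (h1 B hB), add_zero,
            collapse_zero]
      refine h.dom ?_
      rw [sum_extendZero]
      have h1 : Dom (k + 1)
          (∑ i, collapse α.ord (k + 1) (∑ B ∈ Γs i, a B + cL i))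
          (∑ i, ∑ B ∈ Γs i, a B + ∑ i, cL i) := by
        rw [← Finset.sum_add_distrib]
        exact Dom.sum _ fun i _ => dom_collapse _ _ _
      have h2 : Dom (k + 1) (∑ B ∈ Γ ∪ Finset.univ.biUnion Γs, Env.mult Γ Γs B • a B)
          (∑ B ∈ Γ ∪ Finset.univ.biUnion Γs, (a B +
            (if B.flag = .pr then Env.mult Γ Γs B - 1 else 0) •
              Pi.single (B.sort.ord + 1) 1)) := by
        refine Dom.sum _ fun B hB => ?_
        obtain ⟨l, hl⟩ := Nat.exists_eq_add_of_le' (Env.one_le_mult Γ Γs hB)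
        rw [hl]
        split_ifs with hp
        · rw [Nat.add_sub_cancel]
          exact dom_nsmul (hΔ _ B.var) (ha B hB).1 l
        · rw [(ha B hB).2.1 (PFlag.eq_np_iff.2 hp)]
          simpa using Dom.refl _ _
      rw [← Env.sum_mult, Finset.sum_add_distrib] at h2
      have h3 := (Dom.refl _ (∑ B ∈ Γ, a B + cK)).add h1
      rw [add_add_add_comm (∑ B ∈ Γ, a B) cK] at h3
      refine h3.trans ((h2.add_right (cK + ∑ i, cL i)).trans ?_)
      rw [add_assoc, add_comm (cK + _)]
      exact Dom.refl _ _

theorem Deriv.eval_le_tower {m : ℕ} {M : Tm [] .o} {f : PFlag} {τ : Ty .o}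
    (D : Deriv ∅ M f τ) (hM : M.complexity ≤ m) :
    (show ℕ from M.eval countAlg Valn.nil) ≤ tower (m + 1) fun _ => D.val := by
  obtain ⟨c, hc, h⟩ := exists_upper_eval D (Nat.lt_succ_of_le hM) (fun _ x => nomatch x)
  have h' : (show ℕ from M.eval countAlg Valn.nil) ≤ tower (m + 1) (0 + c) :=
    h Valn.nil (fun _ => 0) (by simp)
  rw [zero_add] at h'
  exact h'.trans (tower_mono _ hc)

end Stlc

theorem theorem1 :
    -- (D1)
    (∀ m : ℕ, ∃ η : ℕ → ℕ, ∀ M : Stlc.Tm [] Stlc.Srt.o, M.Homogeneous → M.complexity ≤ m →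
      ∀ (f : Stlc.PFlag) (D : Stlc.Deriv ∅ M f Stlc.Ty.r),
        -- `N` is the unique beta-normal form of `M`
        ∃ N : Stlc.Tm [] Stlc.Srt.o, Stlc.IsNormalFormOf N M ∧
          (∀ N', Stlc.IsNormalFormOf N' M → N' = N) ∧
          D.val ≤ N.countA ∧ N.countA ≤ η D.val) ∧
    -- (D2)
    (∀ M : Stlc.Tm [] Stlc.Srt.o, ∃ f : Stlc.PFlag, Nonempty (Stlc.Deriv ∅ M f Stlc.Ty.r)) := by
  -- The constant vector `v` dominates every weight vector whose entries are at most the value `v`.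
  refine ⟨fun m => ⟨fun v => Stlc.tower (m + 1) fun _ => v, fun M _ hM f D => ?_⟩,
    Stlc.exists_deriv⟩
  obtain ⟨N, hN, huniq, hcount⟩ := Stlc.exists_unique_normalForm M
  exact ⟨N, hN, huniq, hcount ▸ D.val_le_eval, hcount ▸ D.eval_le_tower hM⟩
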